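/- Let $M$ be a smooth finite-dimensional manifold (Hausdorff, second countable, without boundary). Let $T^*[1]M$ be the graded manifold over $M$ whose homogeneous functions of degree $k$ are the $k$-multivector fields on $M$, and let $\lambda=\sum_i p_i\,dx^i$ be its Liouville one-form, where $x^i$ are local coordinates of degree $0$ on $M$ and $p_i=\partial/\partial x^i$ are the corresponding coordinates of degree $1$; let $\omega=d\lambda$ be the canonical symplectic form. (Differential forms on a graded manifold form an algebra that is graded-commutative for the total degree, i.e. the sum of the form degree and the degree of the coordinates.) Let $\mathcal M=T^*[1]M\times\mathbb R[1]\times\mathbb R$, with coordinates $\theta$ of degree $1$ on $\mathbb R[1]$ and $t$ of degree $0$ on $\mathbb R$, and let $\tilde\omega=d\bigl(e^t(d\theta+\lambda)\bigr)$ be the symplectization of the contact form $d\theta+\lambda$ on $T^*[1]M\times\mathbb R[1]$. Then: (1) $\tilde\omega=e^t\bigl(dt\,(d\theta+\lambda)+\omega\bigr)$. (2) The identification of $T^*[1](M\times\mathbb R)$ with $\mathcal M$ in which $\theta$ corresponds to $\partial/\partial t$ is a diffeomorphism of graded manifolds, and under it the canonical symplectic form of $T^*[1](M\times\mathbb R)$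 is $\omega+dt\,d\theta$. (3) There is a unique morphism of graded manifolds $\xi:\mathcal M\to\mathcal M$ with $\xi^*f=e^{|f|t}f$ for every homogeneous function $f$ of degree $|f|$. It is a diffeomorphism, and $\xi^*(\omega+dt\,d\theta)=\tilde\omega$. -/

import Mathlib

open scoped Manifold ContDiff Topology

noncomputable section

namespace DegOne

section Base

variable {E : Type*} [NormedAddCommGroup E] [NormedSpace ℝ E]
  {H : Type*} [TopologicalSpace H] (I : ModelWithCorners ℝ E H)
  (N : Type*) [TopologicalSpace N] [ChartedSpace H N]

/-- The ring of smooth real-valued functions on the manifold `N`. -/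
abbrev Sm : Type _ := C^∞⟮I, N; ℝ⟯

/-- Smooth vector fields on `N`. -/
abbrev VF [IsManifold I ∞ N] : Type _ := Cₛ^∞⟮I; E, (TangentSpace I : N → Type _)⟯

variable {I N}

instance instSMulVF [IsManifold I ∞ N] : SMul (Sm I N) (VF I N) :=
  ⟨fun f X ↦ ⟨fun x ↦ f x • X x, f.contMDiff.smul_section X.contMDiff⟩⟩

@[simp] theorem smul_VF_apply [IsManifold I ∞ N] (f : Sm I N) (X : VF I N) (x : N) :
    (f • X) x = f x • X x := rfl

instance instModuleVF [IsManifold I ∞ N] : Module (Sm I N) (VF I N) where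
  one_smul X := by ext x; exact one_smul ℝ (X x)
  mul_smul f g X := by ext x; exact mul_smul (f x) (g x) (X x)
  smul_zero f := by ext x; exact smul_zero (f x)
  smul_add f X Y := by ext x; exact smul_add (f x) (X x) (Y x)
  add_smul f g X := by ext x; exact add_smul (f x) (g x) (X x)
  zero_smul X := by ext x; exact zero_smul ℝ (X x)

end Base

section Forms

variable {E : Type*} [NormedAddCommGroup E] [NormedSpace ℝ E]
  {H : Type*} [TopologicalSpace H] (I : ModelWithCorners ℝ E H)
  (N : Type*) [TopologicalSpace N] [ChartedSpace H N]
  (P : Type*) [AddCommGroup P] [Module (Sm I N) P]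

/-- A vector bundle `B → N` gives the graded manifold `B[1]` over `N`. With `P = Γ(B*)` the module
of smooth sections of the dual bundle, its algebra of functions is `Γ(⋀ B*) = ⋀ P`, the exterior
power over `C^∞(N)`; functions of degree `k` are the elements of `⋀[Sm I N]^k P`. For `P = VF I N`
these are the multivector fields on `N`, that is, the functions on `T*[1]N`. -/
abbrev Fn : Type _ := ExteriorAlgebra (Sm I N) P

variable {I N P}

/-- The symbol `a` of a function, in the free algebra on symbols `a`, `da`. -/
abbrev symb (a : Fn I N P) : FreeAlgebra ℝ (Fn I N P ⊕ Fn I N P) := FreeAlgebra.ι ℝ (Sum.inl a)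

/-- The symbol `da`, in the free algebra on symbols `a`, `da`. -/
abbrev dsymb (a : Fn I N P) : FreeAlgebra ℝ (Fn I N P ⊕ Fn I N P) := FreeAlgebra.ι ℝ (Sum.inr a)

variable (I N P) in
/-- The relations between the symbols `a`, `da` in the algebra of germs at `x` of differential
forms on the graded manifold with function algebra `Fn I N P`. The algebra is graded commutative
for the total degree, where `a` has degree `|a|` and `da` has degree `|a| + 1`, and `d` is an odd
derivation; `CliffordAlgebra.involute a` is `(-1)^|a| a`. Functions which are `1` near `x` have
germ `1`. The relations `smooth` and `d_smooth` say that `∑ gᵢ dfᵢ` and its differential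
`∑ dgᵢ dfᵢ` are zero if the ordinary `1`-form `∑ gᵢ dfᵢ` on `N` vanishes near `x`. -/
inductive FormRel (x : N) : FreeAlgebra ℝ (Fn I N P ⊕ Fn I N P) →
    FreeAlgebra ℝ (Fn I N P ⊕ Fn I N P) → Prop
  | const (r : ℝ) : FormRel x (symb (algebraMap (Sm I N) _ (algebraMap ℝ (Sm I N) r)))
      (algebraMap ℝ _ r)
  | add (a b : Fn I N P) : FormRel x (symb (a + b)) (symb a + symb b)
  | mul (a b : Fn I N P) : FormRel x (symb (a * b)) (symb a * symb b)
  | germ (f : Sm I N) (hf : ∀ᶠ y in 𝓝 x, f y = 1) : FormRel x (symb (algebraMap (Sm I N) _ f)) 1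
  | d_add (a b : Fn I N P) : FormRel x (dsymb (a + b)) (dsymb a + dsymb b)
  | d_mul (a b : Fn I N P) : FormRel x (dsymb (a * b))
      (dsymb a * symb b + symb (CliffordAlgebra.involute a) * dsymb b)
  | comm_d (i j : ℕ) (a b : Fn I N P) (ha : a ∈ ⋀[Sm I N]^i P) (hb : b ∈ ⋀[Sm I N]^j P) :
      FormRel x (dsymb a * symb b) ((-1) ^ ((i + 1) * j) * (symb b * dsymb a))
  | comm_dd (i j : ℕ) (a b : Fn I N P) (ha : a ∈ ⋀[Sm I N]^i P) (hb : b ∈ ⋀[Sm I N]^j P) :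
      FormRel x (dsymb a * dsymb b) ((-1) ^ ((i + 1) * (j + 1)) * (dsymb b * dsymb a))
  | smooth (n : ℕ) (g f : Fin n → Sm I N)
      (h : ∀ᶠ y in 𝓝 x, ∑ i, g i y • mvfderiv I (f i) y = 0) :
      FormRel x (∑ i, symb (algebraMap (Sm I N) _ (g i)) * dsymb (algebraMap (Sm I N) _ (f i))) 0
  | d_smooth (n : ℕ) (g f : Fin n → Sm I N)
      (h : ∀ᶠ y in 𝓝 x, ∑ i, g i y • mvfderiv I (f i) y = 0) :
      FormRel x (∑ i, dsymb (algebraMap (Sm I N) _ (g i)) * dsymb (algebraMap (Sm I N) _ (f i))) 0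

variable (I N P) in
/-- The algebra of germs at `x` of differential forms. -/
def FormGerm (x : N) : Type _ := RingQuot (FormRel I N P x)

instance instRingFormGerm (x : N) : Ring (FormGerm I N P x) :=
  inferInstanceAs (Ring (RingQuot (FormRel I N P x)))

instance instAlgebraFormGerm (x : N) : Algebra ℝ (FormGerm I N P x) :=
  inferInstanceAs (Algebra ℝ (RingQuot (FormRel I N P x)))

/-- The germ at `x` of a polynomial in the symbols `a`, `da`. -/
def toGerm (x : N) : FreeAlgebra ℝ (Fn I N P ⊕ Fn I N P) →ₐ[ℝ] FormGerm I N P x :=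
  RingQuot.mkAlgHom ℝ (FormRel I N P x)

theorem toGerm_rel {x : N} {v w : FreeAlgebra ℝ (Fn I N P ⊕ Fn I N P)}
    (h : FormRel I N P x v w) : toGerm x v = toGerm x w :=
  RingQuot.mkAlgHom_rel ℝ h

/-- The germ at `x` of the function `a`. -/
def fnGerm (x : N) : Fn I N P →+* FormGerm I N P x where
  toFun a := toGerm x (symb a)
  map_one' := by
    have := toGerm_rel (FormRel.const (I := I) (P := P) (x := x) 1)
    simpa only [map_one] using this
  map_zero' := by
    have := toGerm_rel (FormRel.add (I := I) (P := P) (x := x) 0 0)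
    rw [add_zero, map_add] at this
    exact left_eq_add.1 this
  map_add' a b := by simpa only [map_add] using toGerm_rel (FormRel.add (x := x) a b)
  map_mul' a b := by simpa only [map_mul] using toGerm_rel (FormRel.mul (x := x) a b)

/-- The germ at `x` of `da`. -/
def dfnGerm (x : N) : Fn I N P →+ FormGerm I N P x :=
  AddMonoidHom.mk' (fun a ↦ toGerm x (dsymb a))
    (fun a b ↦ by simpa only [map_add] using toGerm_rel (FormRel.d_add (x := x) a b))

theorem toGerm_symb (x : N) (a : Fn I N P) : toGerm x (symb a) = fnGerm x a := rfl
theorem toGerm_dsymb (x : N) (a : Fn I N P) : toGerm x (dsymb a) = dfnGerm x a := rfl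

/-- An algebra homomorphism out of the algebra of germs, from values on symbols. -/
def germLift {x : N} {A : Type*} [Ring A] [Algebra ℝ A] (c e : Fn I N P → A)
    (h : ∀ v w, FormRel I N P x v w →
      FreeAlgebra.lift ℝ (Sum.elim c e) v = FreeAlgebra.lift ℝ (Sum.elim c e) w) :
    FormGerm I N P x →ₐ[ℝ] A :=
  RingQuot.liftAlgHom ℝ ⟨FreeAlgebra.lift ℝ (Sum.elim c e), fun v w hvw ↦ h v w hvw⟩

theorem germLift_toGerm {x : N} {A : Type*} [Ring A] [Algebra ℝ A] (c e : Fn I N P → A)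
    (h : ∀ v w, FormRel I N P x v w →
      FreeAlgebra.lift ℝ (Sum.elim c e) v = FreeAlgebra.lift ℝ (Sum.elim c e) w)
    (w : FreeAlgebra ℝ (Fn I N P ⊕ Fn I N P)) :
    germLift c e h (toGerm x w) = FreeAlgebra.lift ℝ (Sum.elim c e) w :=
  RingQuot.liftAlgHom_mkAlgHom_apply ℝ _ _ w

theorem involute_of_mem {i : ℕ} {a : Fn I N P} (ha : a ∈ ⋀[Sm I N]^i P) :
    CliffordAlgebra.involute a = (-1) ^ i * a := by
  induction i generalizing a with
  | zero =>
    rw [ExteriorAlgebra.exteriorPower, pow_zero, Submodule.mem_one] at ha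
    obtain ⟨r, rfl⟩ := ha
    simp
  | succ n ih =>
    rw [ExteriorAlgebra.exteriorPower, pow_succ] at ha
    induction ha using Submodule.mul_induction_on' with
    | mem_mul_mem u hu v hv =>
      obtain ⟨m, rfl⟩ := hv
      rw [map_mul, ih hu, CliffordAlgebra.involute_ι]
      simp [pow_succ, mul_assoc]
    | add u hu v hv hu' hv' => rw [map_add, hu', hv', mul_add]

theorem involute_mem {i : ℕ} {a : Fn I N P} (ha : a ∈ ⋀[Sm I N]^i P) :
    CliffordAlgebra.involute a ∈ ⋀[Sm I N]^i P := by
  rw [involute_of_mem ha]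
  rcases neg_one_pow_eq_or (Fn I N P) i with h | h <;> simp [h, ha]

theorem fnGerm_const (x : N) (r : ℝ) :
    fnGerm (I := I) (P := P) x (algebraMap (Sm I N) _ (algebraMap ℝ (Sm I N) r)) = algebraMap ℝ _ r := by
  have := toGerm_rel (FormRel.const (I := I) (P := P) (x := x) r)
  rwa [AlgHom.commutes] at this

theorem fnGerm_germ {x : N} (f : Sm I N) (hf : ∀ᶠ y in 𝓝 x, f y = 1) :
    fnGerm (I := I) (P := P) x (algebraMap (Sm I N) _ f) = 1 := by
  simpa only [map_one, toGerm_symb] using toGerm_rel (FormRel.germ (I := I) (P := P) f hf)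

theorem dfnGerm_mul (x : N) (a b : Fn I N P) : dfnGerm x (a * b) =
    dfnGerm x a * fnGerm x b + fnGerm x (CliffordAlgebra.involute a) * dfnGerm x b := by
  simpa only [map_mul, map_add, toGerm_symb, toGerm_dsymb] using toGerm_rel (FormRel.d_mul (x := x) a b)

theorem dfnGerm_mul_fnGerm (x : N) {i j : ℕ} {a b : Fn I N P} (ha : a ∈ ⋀[Sm I N]^i P)
    (hb : b ∈ ⋀[Sm I N]^j P) :
    dfnGerm x a * fnGerm x b = (-1) ^ ((i + 1) * j) * (fnGerm x b * dfnGerm x a) := by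
  simpa only [map_mul, map_pow, map_neg, map_one, toGerm_symb, toGerm_dsymb] using
    toGerm_rel (FormRel.comm_d (x := x) i j a b ha hb)

theorem dfnGerm_mul_dfnGerm (x : N) {i j : ℕ} {a b : Fn I N P} (ha : a ∈ ⋀[Sm I N]^i P)
    (hb : b ∈ ⋀[Sm I N]^j P) :
    dfnGerm x a * dfnGerm x b = (-1) ^ ((i + 1) * (j + 1)) * (dfnGerm x b * dfnGerm x a) := by
  simpa only [map_mul, map_pow, map_neg, map_one, toGerm_symb, toGerm_dsymb] using
    toGerm_rel (FormRel.comm_dd (x := x) i j a b ha hb)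

theorem sum_fnGerm_mul_dfnGerm {x : N} {n : ℕ} (g f : Fin n → Sm I N)
    (h : ∀ᶠ y in 𝓝 x, ∑ i, g i y • mvfderiv I (f i) y = 0) :
    ∑ i, fnGerm (I := I) (P := P) x (algebraMap (Sm I N) _ (g i)) *
      dfnGerm x (algebraMap (Sm I N) _ (f i)) = 0 := by
  simpa only [map_mul, map_sum, map_zero, toGerm_symb, toGerm_dsymb] using toGerm_rel (FormRel.smooth (I := I) (P := P) n g f h)

theorem sum_dfnGerm_mul_dfnGerm {x : N} {n : ℕ} (g f : Fin n → Sm I N)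
    (h : ∀ᶠ y in 𝓝 x, ∑ i, g i y • mvfderiv I (f i) y = 0) :
    ∑ i, dfnGerm (I := I) (P := P) x (algebraMap (Sm I N) _ (g i)) *
      dfnGerm x (algebraMap (Sm I N) _ (f i)) = 0 := by
  simpa only [map_mul, map_sum, map_zero, toGerm_symb, toGerm_dsymb] using toGerm_rel (FormRel.d_smooth (I := I) (P := P) n g f h)

theorem dfnGerm_eq_zero {x : N} (f : Sm I N) (h : ∀ᶠ y in 𝓝 x, mvfderiv I f y = 0) :
    dfnGerm (I := I) (P := P) x (algebraMap (Sm I N) _ f) = 0 := by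
  have := sum_fnGerm_mul_dfnGerm (I := I) (P := P) (x := x) (n := 1) (fun _ ↦ 1) (fun _ ↦ f)
    (h.mono fun y hy ↦ by simp [hy])
  simpa using this

theorem sum_upper {R : Type*} [Ring R] {n : ℕ} (a b c : Fin n → R) :
    ∑ i, !![a i, b i; 0, c i] = !![∑ i, a i, ∑ i, b i; 0, ∑ i, c i] := by
  ext i j
  rw [Matrix.sum_apply]
  fin_cases i <;> fin_cases j <;> simp

theorem dfnGerm_neg_one_pow_mul (x : N) (i : ℕ) (a : Fn I N P) :
    dfnGerm x ((-1) ^ i * a) = (-1) ^ i * dfnGerm x a := by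
  rcases Nat.even_or_odd i with h | h <;> simp [h.neg_one_pow]

theorem neg_one_pow_mul_upper {R : Type*} [Ring R] (k : ℕ) (a b c : R) :
    (-1) ^ k * !![a, b; 0, c] = !![(-1) ^ k * a, (-1) ^ k * b; 0, (-1) ^ k * c] := by
  rcases Nat.even_or_odd k with h | h <;> simp [h.neg_one_pow]

theorem upper_mul_upper {R : Type*} [Ring R] (a b c a' b' c' : R) :
    !![a, b; 0, c] * !![a', b'; 0, c'] = !![a * a', a * b' + b * c'; 0, c * c'] := by
  simp

theorem upper_congr {R : Type*} [Ring R] {a b c a' b' c' : R} (ha : a = a') (hb : b = b')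
    (hc : c = c') : !![a, b; 0, c] = !![a', b'; 0, c'] := by rw [ha, hb, hc]

/-- The homomorphism `w ↦ [[(-1)^|w| w, dw], [0, w]]`; the upper right entry is an odd derivation
exactly because this is multiplicative. -/
def dMatrix (x : N) : FormGerm I N P x →ₐ[ℝ] Matrix (Fin 2) (Fin 2) (FormGerm I N P x) :=
  germLift
    (fun a ↦ !![fnGerm x (CliffordAlgebra.involute a), dfnGerm x a; 0, fnGerm x a])
    (fun a ↦ !![-dfnGerm x (CliffordAlgebra.involute a), 0; 0, dfnGerm x a])
    (by
      intro v w h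
      induction h with
      | const r =>
        simp only [FreeAlgebra.lift_ι_apply, Sum.elim_inl, AlgHom.commutes]
        rw [fnGerm_const, dfnGerm_eq_zero]
        · ext i j
          fin_cases i <;> fin_cases j <;> simp [Matrix.algebraMap_matrix_apply]
        · refine Filter.Eventually.of_forall fun y ↦ ?_
          exact mvfderiv_const r
      | add a b =>
        simp only [FreeAlgebra.lift_ι_apply, Sum.elim_inl, map_add]
        simp
      | mul a b =>
        simp only [FreeAlgebra.lift_ι_apply, Sum.elim_inl, map_mul]
        rw [upper_mul_upper, dfnGerm_mul, add_comm]
      | germ f hf =>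
        simp only [FreeAlgebra.lift_ι_apply, Sum.elim_inl, AlgHom.commutes, map_one]
        rw [fnGerm_germ f hf, dfnGerm_eq_zero, Matrix.one_fin_two]
        refine hf.eventually_nhds.mono fun y hy ↦ ?_
        have : (f : N → ℝ) =ᶠ[𝓝 y] fun _ ↦ (1 : ℝ) := hy
        rw [mvfderiv, this.mfderiv_eq, mfderiv_const]
        rfl
      | d_add a b =>
        simp only [FreeAlgebra.lift_ι_apply, Sum.elim_inr, map_add, neg_add]
        simp
      | d_mul a b =>
        simp only [FreeAlgebra.lift_ι_apply, Sum.elim_inr, Sum.elim_inl, map_mul, map_add]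
        rw [upper_mul_upper, upper_mul_upper]
        simp [dfnGerm_mul]
        exact add_comm _ _
      | comm_d i j a b ha hb =>
        simp only [FreeAlgebra.lift_ι_apply, Sum.elim_inr, Sum.elim_inl, map_mul, map_pow,
          map_neg, map_one]
        rw [upper_mul_upper, upper_mul_upper, neg_one_pow_mul_upper]
        refine upper_congr ?_ ?_ (dfnGerm_mul_fnGerm x ha hb)
        · rw [neg_mul, dfnGerm_mul_fnGerm x (involute_mem ha) (involute_mem hb)]
          simp
        · rw [involute_of_mem ha, dfnGerm_neg_one_pow_mul]
          simp only [mul_zero, zero_mul, zero_add, add_zero]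
          rw [neg_mul, mul_assoc, dfnGerm_mul_dfnGerm x ha hb, ← mul_assoc, ← pow_add, ← neg_mul,
            ← neg_one_mul, ← pow_succ']
          congr 1
          rw [show i + (i + 1) * (j + 1) + 1 = (i + 1) * j + 2 * (i + 1) by ring, pow_add, pow_mul]
          simp
      | comm_dd i j a b ha hb =>
        simp only [FreeAlgebra.lift_ι_apply, Sum.elim_inr, map_mul, map_pow,
          map_neg, map_one]
        rw [upper_mul_upper, upper_mul_upper, neg_one_pow_mul_upper]
        refine upper_congr ?_ (by simp) (dfnGerm_mul_dfnGerm x ha hb)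
        rw [neg_mul_neg, neg_mul_neg, dfnGerm_mul_dfnGerm x (involute_mem ha) (involute_mem hb)]
      | smooth n g f h =>
        simp only [FreeAlgebra.lift_ι_apply, Sum.elim_inr, Sum.elim_inl, map_sum, map_mul, map_zero,
          AlgHom.commutes, upper_mul_upper, sum_upper]
        simp [sum_fnGerm_mul_dfnGerm g f h, sum_dfnGerm_mul_dfnGerm g f h]
        ext i j
        fin_cases i <;> fin_cases j <;> rfl
      | d_smooth n g f h =>
        simp only [FreeAlgebra.lift_ι_apply, Sum.elim_inr, map_sum, map_mul, map_zero,
          AlgHom.commutes, upper_mul_upper, sum_upper]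
        simp [sum_dfnGerm_mul_dfnGerm g f h]
        ext i j
        fin_cases i <;> fin_cases j <;> rfl)

/-- The de Rham differential on germs at `x`. -/
def dGerm (x : N) : FormGerm I N P x →ₗ[ℝ] FormGerm I N P x where
  toFun w := dMatrix x w 0 1
  map_add' v w := by rw [map_add]; rfl
  map_smul' r w := by rw [map_smul]; rfl

/-- The lift of `dMatrix` to polynomials in the symbols `a`, `da`. -/
def dFree : FreeAlgebra ℝ (Fn I N P ⊕ Fn I N P) →ₐ[ℝ]
    Matrix (Fin 2) (Fin 2) (FreeAlgebra ℝ (Fn I N P ⊕ Fn I N P)) :=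
  FreeAlgebra.lift ℝ (Sum.elim
    (fun a ↦ !![symb (CliffordAlgebra.involute a), dsymb a; 0, symb a])
    (fun a ↦ !![-dsymb (CliffordAlgebra.involute a), 0; 0, dsymb a]))

theorem dMatrix_fnGerm (x : N) (a : Fn I N P) : dMatrix x (fnGerm x a) =
    !![fnGerm x (CliffordAlgebra.involute a), dfnGerm x a; 0, fnGerm x a] := by
  rw [← toGerm_symb, dMatrix, germLift_toGerm, FreeAlgebra.lift_ι_apply]
  rfl

theorem dMatrix_dfnGerm (x : N) (a : Fn I N P) : dMatrix x (dfnGerm x a) =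
    !![-dfnGerm x (CliffordAlgebra.involute a), 0; 0, dfnGerm x a] := by
  rw [← toGerm_dsymb, dMatrix, germLift_toGerm, FreeAlgebra.lift_ι_apply]
  rfl

theorem mapMatrix_dFree (x : N) (w : FreeAlgebra ℝ (Fn I N P ⊕ Fn I N P)) :
    (toGerm x).mapMatrix (dFree w) = dMatrix x (toGerm x w) := by
  have : ((toGerm x).mapMatrix).comp (dFree (I := I) (N := N) (P := P)) =
      (dMatrix x).comp (toGerm x) := by
    refine FreeAlgebra.hom_ext (funext fun a ↦ ?_)
    rcases a with a | a
    · simp only [Function.comp_apply, AlgHom.comp_apply, dFree, FreeAlgebra.lift_ι_apply,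
        Sum.elim_inl]
      rw [toGerm_symb, dMatrix_fnGerm]
      ext i j
      fin_cases i <;> fin_cases j <;> simp [toGerm_symb, toGerm_dsymb]
    · simp only [Function.comp_apply, AlgHom.comp_apply, dFree, FreeAlgebra.lift_ι_apply,
        Sum.elim_inr]
      rw [toGerm_dsymb, dMatrix_dfnGerm]
      ext i j
      fin_cases i <;> fin_cases j <;> simp [toGerm_dsymb]
  exact DFunLike.congr_fun this w

theorem toGerm_dFree (x : N) (w : FreeAlgebra ℝ (Fn I N P ⊕ Fn I N P)) :
    toGerm x (dFree w 0 1) = dGerm x (toGerm x w) :=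
  congrFun (congrFun (mapMatrix_dFree x w) 0) 1

variable (I N P) in
/-- Differential forms on the graded manifold with function algebra `Fn I N P`: sections over `N`
of the sheaf of germs of forms, that is, families of germs which near each point are the germs of
one polynomial in functions and differentials of functions. -/
def Form : Subalgebra ℝ (∀ x : N, FormGerm I N P x) where
  carrier := {s | ∀ x, ∃ w, ∀ᶠ y in 𝓝 x, s y = toGerm y w}
  mul_mem' {s t} hs ht x := by
    obtain ⟨v, hv⟩ := hs x
    obtain ⟨w, hw⟩ := ht x
    refine ⟨v * w, ?_⟩
    filter_upwards [hv, hw] with y h1 h2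
    rw [Pi.mul_apply, h1, h2, map_mul]
  add_mem' {s t} hs ht x := by
    obtain ⟨v, hv⟩ := hs x
    obtain ⟨w, hw⟩ := ht x
    refine ⟨v + w, ?_⟩
    filter_upwards [hv, hw] with y h1 h2
    rw [Pi.add_apply, h1, h2, map_add]
  algebraMap_mem' r x := ⟨algebraMap ℝ _ r, by
    filter_upwards with y
    rw [AlgHom.commutes, Pi.algebraMap_apply]⟩

/-- A function, as a differential form. -/
def fn : Fn I N P →+* Form I N P where
  toFun a := ⟨fun x ↦ fnGerm x a, fun _ ↦ ⟨symb a, Filter.Eventually.of_forall fun _ ↦ rfl⟩⟩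
  map_one' := Subtype.ext (funext fun _ ↦ map_one _)
  map_zero' := Subtype.ext (funext fun _ ↦ map_zero _)
  map_add' _ _ := Subtype.ext (funext fun _ ↦ map_add _ _ _)
  map_mul' _ _ := Subtype.ext (funext fun _ ↦ map_mul _ _ _)

/-- The de Rham differential. -/
def d : Form I N P →ₗ[ℝ] Form I N P where
  toFun s := ⟨fun x ↦ dGerm x (s.1 x), fun x ↦ by
    obtain ⟨w, hw⟩ := s.2 x
    exact ⟨dFree w 0 1, hw.mono fun y hy ↦
      (congrArg (dGerm y) hy).trans (toGerm_dFree y w).symm⟩⟩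
  map_add' s t := Subtype.ext (funext fun x ↦ map_add (dGerm x) (s.1 x) (t.1 x))
  map_smul' r s := Subtype.ext (funext fun x ↦ map_smul (dGerm x) r (s.1 x))

theorem d_fn_apply (a : Fn I N P) (x : N) : (d (fn a)).1 x = dfnGerm x a := by
  change dMatrix x (fnGerm x a) 0 1 = _
  rw [dMatrix_fnGerm]
  rfl

end Forms

section Maps

variable {E : Type*} [NormedAddCommGroup E] [NormedSpace ℝ E]
  {H : Type*} [TopologicalSpace H] (I : ModelWithCorners ℝ E H)
  (N : Type*) [TopologicalSpace N] [ChartedSpace H N]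
  (P : Type*) [AddCommGroup P] [Module (Sm I N) P]
  {E' : Type*} [NormedAddCommGroup E'] [NormedSpace ℝ E']
  {H' : Type*} [TopologicalSpace H'] (I' : ModelWithCorners ℝ E' H')
  (N' : Type*) [TopologicalSpace N'] [ChartedSpace H' N']
  (P' : Type*) [AddCommGroup P'] [Module (Sm I' N') P']

/-- A morphism of graded manifolds, from the one with functions `Fn I N P` to the one with functions
`Fn I' N' P'`: a smooth map of the underlying manifolds, and a degree preserving homomorphism of
rings of functions which on functions of degree `0` is composition with that smooth map. -/
@[ext] structure GHom where
  base : C^∞⟮I, N; I', N'⟯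
  pullback : Fn I' N' P' →+* Fn I N P
  pullback_algebraMap (f : Sm I' N') :
    pullback (algebraMap (Sm I' N') _ f) = algebraMap (Sm I N) _ (f.comp base)
  pullback_mem (k : ℕ) (a : Fn I' N' P') (ha : a ∈ ⋀[Sm I' N']^k P') :
    pullback a ∈ ⋀[Sm I N]^k P

variable {I N P I' N' P'}

/-- A morphism of graded manifolds is a diffeomorphism if it has a two-sided inverse. -/
def GHom.IsDiffeo (φ : GHom I N P I' N' P') : Prop :=
  ∃ ψ : GHom I' N' P' I N P,
    (∀ x, ψ.base (φ.base x) = x) ∧ (∀ y, φ.base (ψ.base y) = y) ∧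
    (∀ a, φ.pullback (ψ.pullback a) = a) ∧ (∀ b, ψ.pullback (φ.pullback b) = b)

theorem GHom.pullback_involute (φ : GHom I N P I' N' P') (a : Fn I' N' P') :
    φ.pullback (CliffordAlgebra.involute a) = CliffordAlgebra.involute (φ.pullback a) := by
  induction a using DirectSum.Decomposition.inductionOn (fun k ↦ ⋀[Sm I' N']^k P') with
  | zero => simp
  | homogeneous a =>
    rw [involute_of_mem a.2, involute_of_mem (φ.pullback_mem _ _ a.2)]
    simp
  | add a b ha hb => simp [ha, hb]

/-- Substitution of pulled back functions in polynomials in the symbols `a`, `da`. -/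
def GHom.pullFree (φ : GHom I N P I' N' P') : FreeAlgebra ℝ (Fn I' N' P' ⊕ Fn I' N' P') →ₐ[ℝ]
    FreeAlgebra ℝ (Fn I N P ⊕ Fn I N P) :=
  FreeAlgebra.lift ℝ (Sum.elim (fun a ↦ symb (φ.pullback a)) (fun a ↦ dsymb (φ.pullback a)))

theorem GHom.smooth_rel (φ : GHom I N P I' N' P') {x : N} {n : ℕ} (g f : Fin n → Sm I' N')
    (h : ∀ᶠ y in 𝓝 (φ.base x), ∑ i, g i y • mvfderiv I' (f i) y = 0) :
    ∀ᶠ y in 𝓝 x, ∑ i, (g i).comp φ.base y • mvfderiv I ((f i).comp φ.base) y = 0 := by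
  filter_upwards [φ.base.contMDiff.continuous.continuousAt.eventually h] with y hy
  have : ∀ i, mvfderiv I ((f i).comp φ.base) y =
      (mvfderiv I' (f i) (φ.base y)).comp (mfderiv I I' φ.base y) := fun i ↦
    mvfderiv_comp y ((f i).contMDiff.mdifferentiable (by simp) _)
      (φ.base.contMDiff.mdifferentiable (by simp) _)
  ext v
  have h2 := congrArg (fun L ↦ L (mfderiv I I' φ.base y v)) hy
  simpa [this] using h2

/-- The pullback of germs of forms. -/
def GHom.pullGerm (φ : GHom I N P I' N' P') (x : N) :
    FormGerm I' N' P' (φ.base x) →ₐ[ℝ] FormGerm I N P x :=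
  germLift (fun a ↦ fnGerm x (φ.pullback a)) (fun a ↦ dfnGerm x (φ.pullback a)) (by
    intro v w h
    induction h with
    | const r =>
      simp only [FreeAlgebra.lift_ι_apply, Sum.elim_inl, AlgHom.commutes]
      rw [φ.pullback_algebraMap]
      exact fnGerm_const x r
    | add a b => simp
    | mul a b => simp
    | germ f hf =>
      simp only [FreeAlgebra.lift_ι_apply, Sum.elim_inl, map_one]
      rw [φ.pullback_algebraMap]
      exact fnGerm_germ _ (φ.base.contMDiff.continuous.continuousAt.eventually hf)
    | d_add a b => simp
    | d_mul a b => simp [dfnGerm_mul, φ.pullback_involute]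
    | comm_d i j a b ha hb =>
      simpa using dfnGerm_mul_fnGerm x (φ.pullback_mem i a ha) (φ.pullback_mem j b hb)
    | comm_dd i j a b ha hb =>
      simpa using dfnGerm_mul_dfnGerm x (φ.pullback_mem i a ha) (φ.pullback_mem j b hb)
    | smooth n g f h =>
      simpa [φ.pullback_algebraMap] using sum_fnGerm_mul_dfnGerm (P := P) _ _ (φ.smooth_rel g f h)
    | d_smooth n g f h =>
      simpa [φ.pullback_algebraMap] using
        sum_dfnGerm_mul_dfnGerm (P := P) _ _ (φ.smooth_rel g f h))

theorem GHom.pullGerm_toGerm (φ : GHom I N P I' N' P') (x : N)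
    (w : FreeAlgebra ℝ (Fn I' N' P' ⊕ Fn I' N' P')) :
    φ.pullGerm x (toGerm _ w) = toGerm x (φ.pullFree w) := by
  have : (φ.pullGerm x).comp (toGerm _) = (toGerm x).comp φ.pullFree := by
    refine FreeAlgebra.hom_ext (funext fun a ↦ ?_)
    rcases a with a | a <;>
    simp only [Function.comp_apply, AlgHom.comp_apply, pullGerm, germLift_toGerm, pullFree,
        FreeAlgebra.lift_ι_apply, Sum.elim_inl, Sum.elim_inr] <;> rfl
  exact DFunLike.congr_fun this w

/-- The pullback of differential forms. -/
def GHom.pullForm (φ : GHom I N P I' N' P') : Form I' N' P' →ₐ[ℝ] Form I N P where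
  toFun s := ⟨fun x ↦ φ.pullGerm x (s.1 (φ.base x)), fun x ↦ by
    obtain ⟨w, hw⟩ := s.2 (φ.base x)
    refine ⟨φ.pullFree w, ?_⟩
    filter_upwards [φ.base.contMDiff.continuous.continuousAt.eventually hw] with y hy
    rw [hy, pullGerm_toGerm]⟩
  map_one' := Subtype.ext (funext fun x ↦ map_one (φ.pullGerm x))
  map_zero' := Subtype.ext (funext fun x ↦ map_zero (φ.pullGerm x))
  map_add' s t := Subtype.ext (funext fun x ↦ map_add (φ.pullGerm x) _ _)
  map_mul' s t := Subtype.ext (funext fun x ↦ map_mul (φ.pullGerm x) _ _)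
  commutes' r := Subtype.ext (funext fun x ↦ (φ.pullGerm x).commutes r)

end Maps

section Liouville

variable {E : Type*} [NormedAddCommGroup E] [NormedSpace ℝ E]
  {H : Type*} [TopologicalSpace H] (I : ModelWithCorners ℝ E H)
  {N : Type*} [TopologicalSpace N] [ChartedSpace H N] [IsManifold I ∞ N]

/-- Functions `f₁, …, fₙ` and vector fields `X₁, …, Xₙ` with `∑ dfᵢ(v) Xᵢ(y) = v` for all tangent
vectors `v` at all points `y` near `x`, for instance coordinates near `x` and the coordinate vector
fields, cut off away from `x`. -/
def IsDualFrame (x : N) {n : ℕ} (f : Fin n → Sm I N) (X : Fin n → VF I N) : Prop :=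
  ∀ᶠ y in 𝓝 x, ∀ v : TangentSpace I y, ∑ i, mvfderiv I (f i) y v • X i y = v

theorem exists_isDualFrame [FiniteDimensional ℝ E] [T2Space N] (x : N) :
    ∃ (n : ℕ) (f : Fin n → Sm I N) (X : Fin n → VF I N), IsDualFrame I x f X := by
  let b := Module.finBasis ℝ E
  let β : SmoothBumpFunction I x := Classical.choice inferInstance
  let e := trivializationAt E (TangentSpace I : N → Type _) x
  have hbase : e.baseSet = (chartAt H x).source := rfl
  have hX : ∀ i, ContMDiff I (I.prod 𝓘(ℝ, E)) ∞
      (fun y ↦ (⟨y, ((β : N → ℝ) • e.localFrame b i) y⟩ : TangentBundle I N)) := fun i ↦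
    ContMDiffOn.smul_section_of_tsupport (u := e.baseSet) β.contMDiff.contMDiffOn
      e.open_baseSet β.tsupport_subset_chartAt_source (e.contMDiffOn_localFrame_baseSet ∞ b i)
  have hφ : ContMDiffOn I 𝓘(ℝ, E) ∞ (extChartAt I x) (chartAt H x).source := contMDiffOn_extChartAt
  have hf : ∀ i, ContMDiffOn I 𝓘(ℝ, ℝ) ∞ (fun y ↦ b.coord i (extChartAt I x y))
      (chartAt H x).source := fun i ↦
    ((LinearMap.toContinuousLinearMap (b.coord i)).contMDiff.comp_contMDiffOn hφ)
  refine ⟨_, fun i ↦ ⟨fun y ↦ β y • b.coord i (extChartAt I x y), β.contMDiff_smul (hf i)⟩,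
    fun i ↦ ⟨_, hX i⟩, ?_⟩
  filter_upwards [β.eventuallyEq_one.eventually_nhds,
    (chartAt H x).open_source.mem_nhds (mem_chart_source H x)] with y hy hys v
  have h1 : ∀ i, mvfderiv I (fun y ↦ β y • b.coord i (extChartAt I x y)) y v =
      b.coord i (e.continuousLinearMapAt ℝ y v) := by
    intro i
    have : (fun y ↦ β y • b.coord i (extChartAt I x y)) =ᶠ[𝓝 y]
        (LinearMap.toContinuousLinearMap (b.coord i)) ∘ (extChartAt I x) := by
      filter_upwards [hy] with z hz
      simp [hz]
    rw [mvfderiv, this.mfderiv_eq, TangentBundle.continuousLinearMapAt_trivializationAt hys,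
      mfderiv_comp y (ContinuousLinearMap.mdifferentiableAt _)
        (mdifferentiableAt_extChartAt hys), ContinuousLinearMap.mfderiv_eq]
    rfl
  have h2 : ∀ i, ((β : N → ℝ) • e.localFrame b i) y = e.symmL ℝ y (b i) := by
    intro i
    have : β y = 1 := hy.self_of_nhds
    rw [Pi.smul_apply', this, one_smul, e.localFrame_apply_of_mem_baseSet b hys]
    rw [e.symmL_apply hys]
    simp only [Bundle.Trivialization.basisAt, Module.Basis.map_apply]
    exact e.linearEquivAt_symm_apply y hys (b i)
  change ∑ i, mvfderiv I (fun y ↦ β y • b.coord i (extChartAt I x y)) y v •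
    ((β : N → ℝ) • e.localFrame b i) y = v
  simp only [h1, h2]
  have hlin : e.IsLinear ℝ := inferInstance
  rw [← e.symmL_continuousLinearMapAt (R := ℝ) hys v]
  simp only [← map_smul, ← map_sum]
  congr 1
  have := e.continuousLinearMapAt_symmL (R := ℝ) hys
  rw [this]
  exact b.sum_repr _


variable {I}

/-- The smooth function `df(X)`. -/
def VF.deriv (X : VF I N) (f : Sm I N) : Sm I N :=
  ⟨fun y ↦ mvfderiv I f y (X y), by
    have h : ContMDiff I (𝓘(ℝ, ℝ).prod 𝓘(ℝ, ℝ)) ∞ (fun y ↦ tangentMap I 𝓘(ℝ, ℝ) f ⟨y, X y⟩) :=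
      (f.contMDiff.contMDiff_tangentMap (by simp)).comp X.contMDiff
    exact fun y ↦ by simpa [tangentMap, mvfderiv] using! (Bundle.contMDiffAt_totalSpace.1 (h y)).2⟩

@[simp] theorem VF.deriv_apply (X : VF I N) (f : Sm I N) (y : N) :
    X.deriv f y = mvfderiv I f y (X y) := rfl

theorem VF.sum_apply {n : ℕ} (X : Fin n → VF I N) (y : N) : (∑ i, X i) y = ∑ i, X i y :=
  (congrFun (map_sum (ContMDiffSection.coeAddHom I E ∞ (TangentSpace I)) X Finset.univ) y).trans
    (Finset.sum_apply _ _ _)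

/-- Vector fields that agree near `x` have the same germ, as functions on `T*[1]N`. -/
theorem fnGerm_VF_congr [FiniteDimensional ℝ E] [T2Space N] {x : N} (X Y : VF I N)
    (h : ∀ᶠ y in 𝓝 x, X y = Y y) :
    fnGerm (I := I) x (ExteriorAlgebra.ι _ X) = fnGerm x (ExteriorAlgebra.ι _ Y) := by
  obtain ⟨β, -, hβ⟩ := (SmoothBumpFunction.nhds_basis_support (I := I) h).mem_iff.1 h
  let b : Sm I N := ⟨β, β.contMDiff⟩
  have hβ' : b • X = b • Y := by
    ext y
    change β y • X y = β y • Y y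
    by_cases hy : β y = 0
    · rw [hy, zero_smul, zero_smul]
    · exact congrArg (β y • ·) (hβ hy)
  have := congrArg (fun p ↦ fnGerm (I := I) x (ExteriorAlgebra.ι (Sm I N) p)) hβ'
  simp only [map_smul, Algebra.smul_def, map_mul] at this
  rwa [fnGerm_germ b β.eventuallyEq_one, one_mul, one_mul] at this

theorem liouville_aux [FiniteDimensional ℝ E] [T2Space N] {x : N} {n m : ℕ} {f : Fin n → Sm I N}
    {X : Fin n → VF I N} {g : Fin m → Sm I N} {Y : Fin m → VF I N}
    (hX : IsDualFrame I x f X) (hY : IsDualFrame I x g Y) :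
    ∑ i, fnGerm (I := I) x (ExteriorAlgebra.ι _ (X i)) *
      dfnGerm x (algebraMap (Sm I N) _ (f i)) =
    ∑ j, fnGerm (I := I) x (ExteriorAlgebra.ι _ (Y j)) *
      dfnGerm x (algebraMap (Sm I N) _ (g j)) := by
  have h1 : ∀ j, fnGerm (I := I) x (ExteriorAlgebra.ι _ (Y j)) =
      ∑ i, fnGerm x (algebraMap (Sm I N) _ ((Y j).deriv (f i))) *
        fnGerm (I := I) x (ExteriorAlgebra.ι _ (X i)) := by
    intro j
    rw [fnGerm_VF_congr (Y j) (∑ i, (Y j).deriv (f i) • X i)]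
    · simp [Algebra.smul_def]
    · filter_upwards [hX] with y hy
      rw [VF.sum_apply]
      exact (hy (Y j y)).symm
  have h2 : ∀ i, dfnGerm (I := I) (P := VF I N) x (algebraMap (Sm I N) _ (f i)) =
      ∑ j, fnGerm x (algebraMap (Sm I N) _ ((Y j).deriv (f i))) *
        dfnGerm x (algebraMap (Sm I N) _ (g j)) := by
    intro i
    have := sum_fnGerm_mul_dfnGerm (I := I) (P := VF I N) (x := x) (n := m + 1)
      (Fin.cons (-1) fun j ↦ (Y j).deriv (f i)) (Fin.cons (f i) g) (by
        filter_upwards [hY] with y hy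
        ext v
        rw [Fin.sum_univ_succ]
        simp only [Fin.cons_zero, Fin.cons_succ]
        have h3 := congrArg (mvfderiv I (f i) y) (hy v)
        rw [map_sum] at h3
        simp only [map_smul] at h3
        simp only [add_apply, sum_apply, smul_apply, zero_apply]
        rw [← h3]
        simp [mul_comm])
    rw [Fin.sum_univ_succ] at this
    simp only [Fin.cons_zero, Fin.cons_succ, map_neg, map_one, neg_mul, one_mul] at this
    exact (neg_add_eq_zero.1 this)
  simp only [h1, Finset.sum_mul]
  rw [Finset.sum_comm]
  refine Finset.sum_congr rfl fun i _ ↦ ?_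
  rw [h2, Finset.mul_sum]
  refine Finset.sum_congr rfl fun j _ ↦ ?_
  rw [← mul_assoc, ← map_mul, ← map_mul, ← Algebra.commutes]

variable (I N) in
/-- The Liouville `1`-form `λ = ∑ pᵢ dxᵢ` on `T*[1]N`: here `pᵢ` is the coordinate vector field
`∂/∂xᵢ`, considered as a function of degree `1` on `T*[1]N`. -/
def liouville [FiniteDimensional ℝ E] [T2Space N] : Form I N (VF I N) :=
  ⟨fun x ↦
    let f := (exists_isDualFrame I x).choose_spec.choose
    let X := (exists_isDualFrame I x).choose_spec.choose_spec.choose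
    ∑ i, fnGerm x (ExteriorAlgebra.ι _ (X i)) * dfnGerm x (algebraMap (Sm I N) _ (f i)),
  fun x ↦ by
    obtain ⟨n, f, X, h⟩ := exists_isDualFrame I x
    refine ⟨∑ i, symb (ExteriorAlgebra.ι _ (X i)) * dsymb (algebraMap (Sm I N) _ (f i)), ?_⟩
    filter_upwards [Filter.Eventually.eventually_nhds h] with y hy
    simp only [map_sum, map_mul, toGerm_symb, toGerm_dsymb]
    exact liouville_aux (exists_isDualFrame I y).choose_spec.choose_spec.choose_spec hy⟩

/-- The formula for the Liouville form in an arbitrary frame. -/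
theorem liouville_apply [FiniteDimensional ℝ E] [T2Space N] {x : N} {n : ℕ} {f : Fin n → Sm I N}
    {X : Fin n → VF I N} (h : IsDualFrame I x f X) : (liouville I N).1 x =
      ∑ i, fnGerm x (ExteriorAlgebra.ι _ (X i)) * dfnGerm x (algebraMap (Sm I N) _ (f i)) :=
  liouville_aux (exists_isDualFrame I x).choose_spec.choose_spec.choose_spec h

variable (I N) in
/-- The canonical symplectic form `dλ = ∑ dpᵢ dxᵢ` on `T*[1]N`. -/
def canonicalForm [FiniteDimensional ℝ E] [T2Space N] : Form I N (VF I N) := d (liouville I N)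

end Liouville

section LinearMaps

variable {E : Type*} [NormedAddCommGroup E] [NormedSpace ℝ E]
  {H : Type*} [TopologicalSpace H] {I : ModelWithCorners ℝ E H}
  {N : Type*} [TopologicalSpace N] [ChartedSpace H N]
  {P : Type*} [AddCommGroup P] [Module (Sm I N) P]
  {E' : Type*} [NormedAddCommGroup E'] [NormedSpace ℝ E']
  {H' : Type*} [TopologicalSpace H'] {I' : ModelWithCorners ℝ E' H'}
  {N' : Type*} [TopologicalSpace N'] [ChartedSpace H' N']
  {P' : Type*} [AddCommGroup P'] [Module (Sm I' N') P']

/-- Composition with a smooth map, as a homomorphism of rings of functions. -/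
def compHom (φ : C^∞⟮I, N; I', N'⟯) : Sm I' N' →+* Sm I N where
  toFun f := f.comp φ
  map_one' := rfl
  map_mul' _ _ := rfl
  map_zero' := rfl
  map_add' _ _ := rfl

/-- The homomorphism of exterior algebras induced by a map of modules which is linear along a
homomorphism of rings of functions. -/
def extMap (φ : C^∞⟮I, N; I', N'⟯) (L : P' →ₛₗ[compHom φ] P) : Fn I' N' P' →+* Fn I N P :=
  letI : Algebra (Sm I' N') (Fn I N P) :=
    ((algebraMap (Sm I N) (Fn I N P)).comp (compHom φ)).toAlgebra' fun c x ↦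
      Algebra.commutes (compHom φ c) x
  (ExteriorAlgebra.lift (Sm I' N') ⟨
    { toFun := fun p ↦ ExteriorAlgebra.ι (Sm I N) (L p)
      map_add' := fun p q ↦ by simp
      map_smul' := fun f p ↦ by
        rw [map_smulₛₗ, map_smul, Algebra.smul_def]
        rfl },
    fun p ↦ ExteriorAlgebra.ι_sq_zero _⟩ : Fn I' N' P' →ₐ[Sm I' N'] Fn I N P).toRingHom

theorem extMap_algebraMap (φ : C^∞⟮I, N; I', N'⟯) (L : P' →ₛₗ[compHom φ] P) (f : Sm I' N') :
    extMap φ L (algebraMap (Sm I' N') _ f) = algebraMap (Sm I N) _ (f.comp φ) :=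
  letI : Algebra (Sm I' N') (Fn I N P) :=
    ((algebraMap (Sm I N) (Fn I N P)).comp (compHom φ)).toAlgebra' fun c x ↦
      Algebra.commutes (compHom φ c) x
  AlgHom.commutes (ExteriorAlgebra.lift (Sm I' N') _ : Fn I' N' P' →ₐ[Sm I' N'] Fn I N P) f

theorem extMap_ι (φ : C^∞⟮I, N; I', N'⟯) (L : P' →ₛₗ[compHom φ] P) (p : P') :
    extMap φ L (ExteriorAlgebra.ι (Sm I' N') p) = ExteriorAlgebra.ι (Sm I N) (L p) :=
  letI : Algebra (Sm I' N') (Fn I N P) :=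
    ((algebraMap (Sm I N) (Fn I N P)).comp (compHom φ)).toAlgebra' fun c x ↦
      Algebra.commutes (compHom φ c) x
  ExteriorAlgebra.lift_ι_apply (Sm I' N') _ _ p

theorem extMap_mem (φ : C^∞⟮I, N; I', N'⟯) (L : P' →ₛₗ[compHom φ] P) (k : ℕ) (a : Fn I' N' P')
    (ha : a ∈ ⋀[Sm I' N']^k P') : extMap φ L a ∈ ⋀[Sm I N]^k P := by
  induction k generalizing a with
  | zero =>
    rw [ExteriorAlgebra.exteriorPower, pow_zero, Submodule.mem_one] at ha ⊢
    obtain ⟨r, rfl⟩ := ha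
    exact ⟨_, (extMap_algebraMap φ L r).symm⟩
  | succ n ih =>
    rw [ExteriorAlgebra.exteriorPower, pow_succ] at ha ⊢
    induction ha using Submodule.mul_induction_on' with
    | mem_mul_mem u hu v hv =>
      obtain ⟨m, rfl⟩ := hv
      rw [map_mul, extMap_ι]
      exact Submodule.mul_mem_mul (ih u hu) ⟨_, rfl⟩
    | add u hu v hv hu' hv' => rw [map_add]; exact add_mem hu' hv'

/-- The morphism of graded manifolds given by a smooth map and a linear map along it. -/
def GHom.ofLinear (φ : C^∞⟮I, N; I', N'⟯) (L : P' →ₛₗ[compHom φ] P) : GHom I N P I' N' P' where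
  base := φ
  pullback := extMap φ L
  pullback_algebraMap := extMap_algebraMap φ L
  pullback_mem := extMap_mem φ L

end LinearMaps

section Product

variable {E : Type*} [NormedAddCommGroup E] [NormedSpace ℝ E]
  {H : Type*} [TopologicalSpace H] (I : ModelWithCorners ℝ E H)
  (M : Type*) [TopologicalSpace M] [ChartedSpace H M] [IsManifold I ∞ M]

/-- The ring of smooth functions on `M × ℝ`. -/
abbrev SmR : Type _ := Sm (I.prod 𝓘(ℝ, ℝ)) (M × ℝ)

/-- The vector fields on `M × ℝ`. -/
abbrev VFR : Type _ := VF (I.prod 𝓘(ℝ, ℝ)) (M × ℝ)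

variable {I M} in
/-- The `ℝ`-component of a tangent vector of `M × ℝ`. -/
def vertical {p : M × ℝ} (v : TangentSpace (I.prod 𝓘(ℝ, ℝ)) p) : ℝ :=
  Prod.snd (α := E) (β := ℝ) v

/-- The vector fields on `M × ℝ` with zero `ℝ`-component: these are the sections of the pullback
of the tangent bundle of `M` along the projection `M × ℝ → M`. -/
def HorVF : Submodule (SmR I M) (VFR I M) where
  carrier := {X | ∀ p, vertical (X p) = 0}
  add_mem' {X Y} hX hY p := by
    change vertical (X p) + vertical (Y p) = 0
    rw [hX, hY, add_zero]
  zero_mem' p := rfl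
  smul_mem' f X hX p := by
    change f p • vertical (X p) = 0
    rw [hX, smul_zero]

/-- The module of linear functions on the fibers of `T*[1]M × ℝ[1] × ℝ` over `M × ℝ`: a linear
function on the fibers of `T*[1]M × ℝ` plus a multiple of the coordinate of `ℝ[1]`. -/
abbrev ProdMod : Type _ := HorVF I M × SmR I M

/-- The algebra of functions on `T*[1]M × ℝ[1] × ℝ`. -/
abbrev ProdFn : Type _ := Fn (I.prod 𝓘(ℝ, ℝ)) (M × ℝ) (ProdMod I M)

/-- Differential forms on `T*[1]M × ℝ[1] × ℝ`. -/
abbrev ProdForm : Type _ := Form (I.prod 𝓘(ℝ, ℝ)) (M × ℝ) (ProdMod I M)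

/-- The coordinate `t` of the factor `ℝ`, as a smooth function on `M × ℝ`. -/
def tCoord : SmR I M := ⟨Prod.snd, contMDiff_snd⟩

/-- The smooth function `e^(rt)` on `M × ℝ`. -/
def expT (r : ℝ) : SmR I M :=
  ⟨fun p ↦ Real.exp (r * p.2),
    (Real.contDiff_exp.comp (contDiff_const.mul contDiff_id)).contMDiff.comp contMDiff_snd⟩

/-- The coordinate `θ` of the factor `ℝ[1]`. -/
def theta : ProdFn I M := ExteriorAlgebra.ι _ (0, 1)

variable {I M} in
/-- The vector field on `M × ℝ` which is `X` in the direction of `M`. -/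
def liftVF (X : VF I M) : HorVF I M :=
  ⟨⟨fun p ↦ (X p.1, (0 : ℝ)), by
    have h1 : ContMDiff (I.prod 𝓘(ℝ, ℝ)) I.tangent ∞
        (fun p : M × ℝ ↦ (⟨p.1, X p.1⟩ : TangentBundle I M)) := X.contMDiff.comp contMDiff_fst
    have h2 : ContMDiff (I.prod 𝓘(ℝ, ℝ)) 𝓘(ℝ, ℝ).tangent ∞
        (fun p : M × ℝ ↦ (⟨p.2, (0 : ℝ)⟩ : TangentBundle 𝓘(ℝ, ℝ) ℝ)) :=
      (Bundle.contMDiff_zeroSection ℝ (TangentSpace 𝓘(ℝ, ℝ) : ℝ → Type _)).comp contMDiff_snd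
    exact contMDiff_equivTangentBundleProd_symm.comp (h1.prodMk h2)⟩, fun p ↦ rfl⟩

/-- The vector field `∂/∂t` on `M × ℝ`. -/
def ddt : VFR I M :=
  ⟨fun p ↦ ((0 : E), (1 : ℝ)), by
    have h1 : ContMDiff (I.prod 𝓘(ℝ, ℝ)) I.tangent ∞
        (fun p : M × ℝ ↦ (⟨p.1, (0 : E)⟩ : TangentBundle I M)) :=
      (Bundle.contMDiff_zeroSection ℝ (TangentSpace I : M → Type _)).comp contMDiff_fst
    have h2 : ContMDiff (I.prod 𝓘(ℝ, ℝ)) 𝓘(ℝ, ℝ).tangent ∞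
        (fun p : M × ℝ ↦ (⟨p.2, (1 : ℝ)⟩ : TangentBundle 𝓘(ℝ, ℝ) ℝ)) := by
      refine ContMDiff.comp (g := fun t : ℝ ↦ (⟨t, (1 : ℝ)⟩ : TangentBundle 𝓘(ℝ, ℝ) ℝ)) ?_
        contMDiff_snd
      intro t
      rw [Bundle.contMDiffAt_totalSpace]
      exact ⟨contMDiffAt_id, by simpa using contMDiffAt_const⟩
    exact contMDiff_equivTangentBundleProd_symm.comp (h1.prodMk h2)⟩

/-- The projection of `T*[1]M × ℝ[1] × ℝ` onto `T*[1]M`. -/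
def prodProj : GHom (I.prod 𝓘(ℝ, ℝ)) (M × ℝ) (ProdMod I M) I M (VF I M) :=
  GHom.ofLinear ⟨Prod.fst, contMDiff_fst⟩
    { toFun := fun X ↦ (liftVF X, 0)
      map_add' := fun X Y ↦ by
        refine Prod.ext (Subtype.ext ?_) (add_zero _).symm
        ext p
        exact Prod.ext rfl (add_zero _).symm
      map_smul' := fun f X ↦ by
        refine Prod.ext (Subtype.ext ?_) (smul_zero _).symm
        ext p
        exact Prod.ext rfl (smul_zero (f p.1)).symm }

variable {I M} in
theorem mvfderiv_tCoord {p : M × ℝ} (v : TangentSpace (I.prod 𝓘(ℝ, ℝ)) p) :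
    mvfderiv (I.prod 𝓘(ℝ, ℝ)) (tCoord I M) p v = vertical v := by
  have : mfderiv (I.prod 𝓘(ℝ, ℝ)) 𝓘(ℝ, ℝ) (tCoord I M) p = _ := mfderiv_snd (x := p)
  rw [mvfderiv, this]
  rfl

/-- The splitting of vector fields on `M × ℝ` into horizontal vector fields and multiples
of `∂/∂t`. -/
def splitVF : VFR I M →ₗ[SmR I M] ProdMod I M where
  toFun X := (⟨X - X.deriv (tCoord I M) • ddt I M, fun p ↦ by
    change vertical (X p) - mvfderiv _ (tCoord I M) p (X p) * 1 = 0
    rw [mvfderiv_tCoord, mul_one, sub_self]⟩, X.deriv (tCoord I M))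
  map_add' X Y := by
    have h : (X + Y).deriv (tCoord I M) = X.deriv (tCoord I M) + Y.deriv (tCoord I M) := by
      ext p
      exact map_add (mvfderiv _ (tCoord I M) p) (X p) (Y p)
    refine Prod.ext (Subtype.ext ?_) h
    simp only [h, add_smul, Prod.mk_add_mk, Submodule.coe_add]
    abel
  map_smul' f X := by
    have h : (f • X).deriv (tCoord I M) = f • X.deriv (tCoord I M) := by
      ext p
      exact map_smul (mvfderiv _ (tCoord I M) p) (f p) (X p)
    refine Prod.ext (Subtype.ext ?_) h
    simp [h, smul_sub, mul_smul]

/-- The identification of `T*[1]M × ℝ[1] × ℝ` with `T*[1](M × ℝ)`; it pulls back the function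
`∂/∂t` to the coordinate `θ`. -/
def prodIdent : GHom (I.prod 𝓘(ℝ, ℝ)) (M × ℝ) (ProdMod I M)
    (I.prod 𝓘(ℝ, ℝ)) (M × ℝ) (VFR I M) :=
  GHom.ofLinear ContMDiffMap.id
    { toFun := splitVF I M
      map_add' := map_add _
      map_smul' := fun f X ↦ map_smul (splitVF I M) f X }

section Symplectization

variable [FiniteDimensional ℝ E] [T2Space M]

/-- The form `dt` on `T*[1]M × ℝ[1] × ℝ`. -/
def dt : ProdForm I M := d (fn (algebraMap (SmR I M) _ (tCoord I M)))

/-- The form `dθ` on `T*[1]M × ℝ[1] × ℝ`. -/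
def dtheta : ProdForm I M := d (fn (theta I M))

/-- The function `e^t`, as a form on `T*[1]M × ℝ[1] × ℝ`. -/
def expForm : ProdForm I M := fn (algebraMap (SmR I M) _ (expT I M 1))

/-- The form `λ` on `T*[1]M × ℝ[1] × ℝ`: the pullback of the Liouville form of `T*[1]M`. -/
def prodLiouville : ProdForm I M := (prodProj I M).pullForm (liouville I M)

/-- The form `ω` on `T*[1]M × ℝ[1] × ℝ`: the pullback of the canonical form of `T*[1]M`. -/
def prodOmega : ProdForm I M := (prodProj I M).pullForm (canonicalForm I M)

/-- The canonical symplectic form of `T*[1](M × ℝ)`, on `T*[1]M × ℝ[1] × ℝ`. -/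
def prodCanonicalForm : ProdForm I M :=
  (prodIdent I M).pullForm (canonicalForm (I.prod 𝓘(ℝ, ℝ)) (M × ℝ))

/-- The symplectization `d(e^t α)` of the contact form `α = λ + dθ` of `T*[1]M × ℝ[1]`. -/
def symplectizationForm : ProdForm I M := d (expForm I M * (prodLiouville I M + dtheta I M))

end Symplectization

end Product

end DegOne

end

open DegOne

namespace DegOne

section Maps

variable {E : Type*} [NormedAddCommGroup E] [NormedSpace ℝ E]
  {H : Type*} [TopologicalSpace H] {I : ModelWithCorners ℝ E H}
  {N : Type*} [TopologicalSpace N] [ChartedSpace H N]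
  {P : Type*} [AddCommGroup P] [Module (Sm I N) P]
  {E' : Type*} [NormedAddCommGroup E'] [NormedSpace ℝ E']
  {H' : Type*} [TopologicalSpace H'] {I' : ModelWithCorners ℝ E' H'}
  {N' : Type*} [TopologicalSpace N'] [ChartedSpace H' N']
  {P' : Type*} [AddCommGroup P'] [Module (Sm I' N') P']

theorem toGerm_surjective (x : N) : Function.Surjective (toGerm (I := I) (P := P) x) :=
  RingQuot.mkAlgHom_surjective ℝ _

theorem GHom.pullGerm_fnGerm (φ : GHom I N P I' N' P') (x : N) (a : Fn I' N' P') :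
    φ.pullGerm x (fnGerm _ a) = fnGerm x (φ.pullback a) := by
  rw [← toGerm_symb, pullGerm, germLift_toGerm, FreeAlgebra.lift_ι_apply]
  rfl

theorem GHom.pullGerm_dfnGerm (φ : GHom I N P I' N' P') (x : N) (a : Fn I' N' P') :
    φ.pullGerm x (dfnGerm _ a) = dfnGerm x (φ.pullback a) := by
  rw [← toGerm_dsymb, pullGerm, germLift_toGerm, FreeAlgebra.lift_ι_apply]
  rfl

theorem GHom.mapMatrix_pullGerm_dMatrix (φ : GHom I N P I' N' P') (x : N)
    (w : FormGerm I' N' P' (φ.base x)) :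
    (φ.pullGerm x).mapMatrix (dMatrix _ w) = dMatrix x (φ.pullGerm x w) := by
  obtain ⟨w, rfl⟩ := toGerm_surjective _ w
  have : (((φ.pullGerm x).mapMatrix).comp (dMatrix _)).comp (toGerm _) =
      ((dMatrix x).comp (φ.pullGerm x)).comp (toGerm _) := by
    refine FreeAlgebra.hom_ext (funext fun a ↦ ?_)
    rcases a with a | a
    · simp only [Function.comp_apply, AlgHom.comp_apply]
      rw [toGerm_symb, dMatrix_fnGerm, pullGerm_fnGerm, dMatrix_fnGerm, ← φ.pullback_involute]
      ext i j
      fin_cases i <;> fin_cases j <;> simp [pullGerm_fnGerm, pullGerm_dfnGerm]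
    · simp only [Function.comp_apply, AlgHom.comp_apply]
      rw [toGerm_dsymb, dMatrix_dfnGerm, pullGerm_dfnGerm, dMatrix_dfnGerm, ← φ.pullback_involute]
      ext i j
      fin_cases i <;> fin_cases j <;> simp [pullGerm_dfnGerm]
  exact DFunLike.congr_fun this w

/-- Pullback commutes with the de Rham differential. -/
theorem GHom.pullForm_d (φ : GHom I N P I' N' P') (s : Form I' N' P') :
    φ.pullForm (d s) = d (φ.pullForm s) :=
  Subtype.ext (funext fun x ↦
    congrFun (congrFun (φ.mapMatrix_pullGerm_dMatrix x (s.1 (φ.base x))) 0) 1)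

theorem GHom.pullForm_fn (φ : GHom I N P I' N' P') (a : Fn I' N' P') :
    φ.pullForm (fn a) = fn (φ.pullback a) :=
  Subtype.ext (funext fun x ↦ φ.pullGerm_fnGerm x a)

theorem GHom.pullForm_apply (φ : GHom I N P I' N' P') (s : Form I' N' P') (x : N) :
    (φ.pullForm s).1 x = φ.pullGerm x (s.1 (φ.base x)) := rfl

theorem dMatrix_zero_one_mul (x : N) (v w : FormGerm I N P x) :
    dMatrix x (v * w) 0 1 = dMatrix x v 0 0 * dMatrix x w 0 1 + dMatrix x v 0 1 * dMatrix x w 1 1 := by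
  rw [map_mul, Matrix.mul_apply, Fin.sum_univ_two]

theorem dMatrix_one (x : N) (w : FormGerm I N P x) :
    dMatrix x w 1 0 = 0 ∧ dMatrix x w 1 1 = w := by
  obtain ⟨w, rfl⟩ := toGerm_surjective x w
  induction w using FreeAlgebra.induction with
  | grade0 r => simp [Matrix.algebraMap_matrix_apply]
  | grade1 a =>
    rcases a with a | a
    · rw [toGerm_symb, dMatrix_fnGerm]
      exact ⟨rfl, rfl⟩
    · rw [toGerm_dsymb, dMatrix_dfnGerm]
      exact ⟨rfl, rfl⟩
  | mul a b ha hb => simp [Matrix.mul_apply, Fin.sum_univ_two, ha, hb]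
  | add a b ha hb => simp [ha, hb]

theorem dMatrix_one_one (x : N) (w : FormGerm I N P x) : dMatrix x w 1 1 = w :=
  (dMatrix_one x w).2

/-- The Leibniz rule for multiplication by a function. -/
theorem d_fn_mul (a : Fn I N P) (s : Form I N P) :
    d (fn a * s) = d (fn a) * s + fn (CliffordAlgebra.involute a) * d s := by
  refine Subtype.ext (funext fun x ↦ ?_)
  change dMatrix x (fnGerm x a * s.1 x) 0 1 = dMatrix x (fnGerm x a) 0 1 * s.1 x +
    fnGerm x (CliffordAlgebra.involute a) * dMatrix x (s.1 x) 0 1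
  rw [dMatrix_zero_one_mul, dMatrix_one_one, dMatrix_fnGerm, add_comm]
  rfl

theorem d_d_fn (a : Fn I N P) : d (d (fn a)) = 0 := by
  refine Subtype.ext (funext fun x ↦ ?_)
  change dMatrix x ((d (fn a)).1 x) 0 1 = 0
  rw [d_fn_apply, dMatrix_dfnGerm]
  rfl

theorem mem_exteriorPower_zero (f : Sm I N) : algebraMap (Sm I N) (Fn I N P) f ∈ ⋀[Sm I N]^0 P := by
  rw [ExteriorAlgebra.exteriorPower, pow_zero, Submodule.mem_one]
  exact ⟨f, rfl⟩

theorem ι_mem_exteriorPower_one (p : P) :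
    ExteriorAlgebra.ι (Sm I N) p ∈ ⋀[Sm I N]^1 P := by
  rw [ExteriorAlgebra.exteriorPower, pow_one]
  exact ⟨p, rfl⟩

theorem d_fn_mul_fn {i j : ℕ} {a b : Fn I N P} (ha : a ∈ ⋀[Sm I N]^i P)
    (hb : b ∈ ⋀[Sm I N]^j P) :
    d (fn a) * fn b = (-1) ^ ((i + 1) * j) * (fn b * d (fn a)) := by
  refine Subtype.ext (funext fun x ↦ ?_)
  have := dfnGerm_mul_fnGerm x ha hb
  rw [← d_fn_apply] at this
  exact this

theorem d_fn_mul_d_fn {i j : ℕ} {a b : Fn I N P} (ha : a ∈ ⋀[Sm I N]^i P)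
    (hb : b ∈ ⋀[Sm I N]^j P) :
    d (fn a) * d (fn b) = (-1) ^ ((i + 1) * (j + 1)) * (d (fn b) * d (fn a)) := by
  refine Subtype.ext (funext fun x ↦ ?_)
  have := dfnGerm_mul_dfnGerm x ha hb
  rw [← d_fn_apply, ← d_fn_apply] at this
  exact this

theorem eq_of_eq_neg_one_pow_mul {R : Type*} [Ring R] {a b : R} {k : ℕ} (hk : Even k)
    (h : a = (-1) ^ k * b) : a = b := by
  rwa [hk.neg_one_pow, one_mul] at h

theorem eq_zero_of_eq_neg_one_pow_mul {R : Type*} [Ring R] [Algebra ℝ R] {a : R} {k : ℕ}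
    (hk : Odd k) (h : a = (-1) ^ k * a) : a = 0 := by
  rw [hk.neg_one_pow, neg_one_mul] at h
  have h2 : (2 : ℝ) • a = 0 := by
    rw [two_smul]
    nth_rewrite 2 [h]
    exact add_neg_cancel _
  exact (smul_eq_zero_iff_right two_ne_zero).1 h2

theorem d_fn_algebraMap_mul (f : Sm I N) (s : Form I N P) :
    d (fn (algebraMap (Sm I N) (Fn I N P) f) * s) =
      d (fn (algebraMap (Sm I N) (Fn I N P) f)) * s + fn (algebraMap (Sm I N) (Fn I N P) f) * d s := by
  rw [d_fn_mul, AlgHom.commutes]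

theorem d_fn_algebraMap_mul_self (f : Sm I N) :
    d (fn (algebraMap (Sm I N) (Fn I N P) f)) * d (fn (algebraMap (Sm I N) (Fn I N P) f)) = 0 :=
  eq_zero_of_eq_neg_one_pow_mul (by decide)
    (d_fn_mul_d_fn (mem_exteriorPower_zero f) (mem_exteriorPower_zero f))

theorem d_fn_ι_mul_d_fn_algebraMap (p : P) (f : Sm I N) :
    d (fn (ExteriorAlgebra.ι (Sm I N) p) * d (fn (algebraMap (Sm I N) (Fn I N P) f))) =
      d (fn (algebraMap (Sm I N) (Fn I N P) f)) * d (fn (ExteriorAlgebra.ι (Sm I N) p)) := by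
  rw [d_fn_mul, d_d_fn, mul_zero, add_zero]
  exact eq_of_eq_neg_one_pow_mul (by decide)
    (d_fn_mul_d_fn (ι_mem_exteriorPower_one p) (mem_exteriorPower_zero f))

theorem d_fn_algebraMap_mul_fn_ι_mul_d (p : P) (f : Sm I N) :
    d (fn (algebraMap (Sm I N) (Fn I N P) f)) *
      (fn (ExteriorAlgebra.ι (Sm I N) p) * d (fn (algebraMap (Sm I N) (Fn I N P) f))) = 0 := by
  rw [← mul_assoc, d_fn_mul_fn (mem_exteriorPower_zero f) (ι_mem_exteriorPower_one p), mul_assoc,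
    mul_assoc, d_fn_algebraMap_mul_self, mul_zero, mul_zero]

/-- The differential of a multiple of a form by a solution `f` of `df = f dg`. -/
theorem d_fn_mul_add {f g : Sm I N} {p : P} {s s' : Form I N P}
    (hf : d (fn (algebraMap (Sm I N) (Fn I N P) f)) =
      fn (algebraMap (Sm I N) (Fn I N P) f) * d (fn (algebraMap (Sm I N) (Fn I N P) g)))
    (hs : d s = s') :
    d (fn (algebraMap (Sm I N) (Fn I N P) f) * (s + d (fn (ExteriorAlgebra.ι (Sm I N) p)))) =
      fn (algebraMap (Sm I N) (Fn I N P) f) * (d (fn (algebraMap (Sm I N) (Fn I N P) g)) *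
        (d (fn (ExteriorAlgebra.ι (Sm I N) p)) + s) + s') := by
  rw [d_fn_algebraMap_mul, hf, map_add, d_d_fn, hs, add_zero, mul_assoc, ← mul_add, add_comm s]

theorem d_fn_mul_add_fn_mul_d {f g : Sm I N} {p : P} {s s' : Form I N P}
    (hf : d (fn (algebraMap (Sm I N) (Fn I N P) f)) =
      fn (algebraMap (Sm I N) (Fn I N P) f) * d (fn (algebraMap (Sm I N) (Fn I N P) g)))
    (hs : d s = s') :
    d (fn (algebraMap (Sm I N) (Fn I N P) f) *
      (s + fn (ExteriorAlgebra.ι (Sm I N) p) * d (fn (algebraMap (Sm I N) (Fn I N P) g)))) =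
      fn (algebraMap (Sm I N) (Fn I N P) f) * (d (fn (algebraMap (Sm I N) (Fn I N P) g)) *
        (d (fn (ExteriorAlgebra.ι (Sm I N) p)) + s) + s') := by
  rw [d_fn_algebraMap_mul, hf, map_add, d_fn_ι_mul_d_fn_algebraMap, hs, mul_assoc, ← mul_add,
    mul_add (d _), d_fn_algebraMap_mul_fn_ι_mul_d, mul_add (d _)]
  congr 1
  abel

theorem extMap_extMap_of_leftInverse {φ : C^∞⟮I, N; I', N'⟯} {ψ : C^∞⟮I', N'; I, N⟯}
    {L : P' →ₛₗ[compHom φ] P} {K : P →ₛₗ[compHom ψ] P'} (hφ : ∀ x, ψ (φ x) = x)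
    (hL : ∀ p, L (K p) = p) (a : Fn I N P) : extMap φ L (extMap ψ K a) = a := by
  induction a using ExteriorAlgebra.induction with
  | algebraMap f =>
    rw [extMap_algebraMap, extMap_algebraMap]
    exact congrArg _ (ContMDiffMap.ext fun x ↦ congrArg f (hφ x))
  | ι p => rw [extMap_ι, extMap_ι, hL]
  | mul a b ha hb => rw [map_mul, map_mul, ha, hb]
  | add a b ha hb => rw [map_add, map_add, ha, hb]

theorem GHom.isDiffeo_ofLinear {φ : C^∞⟮I, N; I', N'⟯} {ψ : C^∞⟮I', N'; I, N⟯}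
    {L : P' →ₛₗ[compHom φ] P} {K : P →ₛₗ[compHom ψ] P'} (hφ : ∀ x, ψ (φ x) = x)
    (hψ : ∀ y, φ (ψ y) = y) (hL : ∀ p, L (K p) = p) (hK : ∀ q, K (L q) = q) :
    (GHom.ofLinear φ L).IsDiffeo :=
  ⟨GHom.ofLinear ψ K, hφ, hψ, extMap_extMap_of_leftInverse hφ hL,
    extMap_extMap_of_leftInverse hψ hK⟩

theorem GHom.ofLinear_pullback_ι (φ : C^∞⟮I, N; I', N'⟯) (L : P' →ₛₗ[compHom φ] P) (p : P') :
    (GHom.ofLinear φ L).pullback (ExteriorAlgebra.ι (Sm I' N') p) =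
      ExteriorAlgebra.ι (Sm I N) (L p) :=
  extMap_ι φ L p

/-- Morphisms into a manifold with enough functions are determined by their pullbacks. -/
theorem GHom.ext_of_pullback [FiniteDimensional ℝ E'] [IsManifold I' ∞ N'] [T2Space N']
    {φ ψ : GHom I N P I' N' P'} (h : ∀ a, φ.pullback a = ψ.pullback a) : φ = ψ := by
  refine GHom.ext (ContMDiffMap.ext fun x ↦ ?_) (RingHom.ext h)
  by_contra hne
  obtain ⟨β, -, hβ⟩ := (SmoothBumpFunction.nhds_basis_support (I := I')
    (compl_singleton_mem_nhds hne)).mem_iff.1 (compl_singleton_mem_nhds hne)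
  let b : Sm I' N' := ⟨β, β.contMDiff⟩
  have h1 := h (algebraMap _ _ b)
  rw [φ.pullback_algebraMap, ψ.pullback_algebraMap] at h1
  have h2 : β (φ.base x) = β (ψ.base x) :=
    congrArg (fun f : Sm I N ↦ f x) ((ExteriorAlgebra.algebraMap_leftInverse P).injective h1)
  rw [β.eq_one] at h2
  exact hβ (Function.mem_support.2 (h2.symm ▸ one_ne_zero)) rfl

theorem GHom.pullForm_apply_of_eq_sum (φ : GHom I N P I' N' P') {s : Form I' N' P'} {x : N}
    {n : ℕ} {a b : Fin n → Fn I' N' P'}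
    (h : s.1 (φ.base x) = ∑ i, fnGerm _ (a i) * dfnGerm _ (b i)) :
    (φ.pullForm s).1 x = ∑ i, fnGerm x (φ.pullback (a i)) * dfnGerm x (φ.pullback (b i)) := by
  rw [pullForm_apply, h, map_sum]
  refine Finset.sum_congr rfl fun i _ ↦ ?_
  rw [map_mul, pullGerm_fnGerm, pullGerm_dfnGerm]

theorem GHom.pullForm_liouville_apply [FiniteDimensional ℝ E'] [IsManifold I' ∞ N'] [T2Space N']
    (φ : GHom I N P I' N' (VF I' N')) {x : N} {n : ℕ} {f : Fin n → Sm I' N'}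
    {X : Fin n → VF I' N'} (h : IsDualFrame I' (φ.base x) f X) :
    (φ.pullForm (liouville I' N')).1 x =
      ∑ i, fnGerm x (φ.pullback (ExteriorAlgebra.ι _ (X i))) *
        dfnGerm x (algebraMap (Sm I N) _ ((f i).comp φ.base)) := by
  rw [φ.pullForm_apply_of_eq_sum (liouville_apply h)]
  refine Finset.sum_congr rfl fun i _ ↦ ?_
  rw [φ.pullback_algebraMap]

end Maps

section Product

variable {E : Type*} [NormedAddCommGroup E] [NormedSpace ℝ E]
  {H : Type*} [TopologicalSpace H] (I : ModelWithCorners ℝ E H)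
  (M : Type*) [TopologicalSpace M] [ChartedSpace H M] [IsManifold I ∞ M]

/-- The inverse of the splitting `splitVF`. -/
noncomputable def joinVF : ProdMod I M →ₗ[SmR I M] VFR I M :=
  (HorVF I M).subtype.coprod (LinearMap.toSpanSingleton _ _ (ddt I M))

variable {I M}

theorem joinVF_apply (q : ProdMod I M) : joinVF I M q = q.1 + q.2 • ddt I M := rfl

theorem joinVF_splitVF (X : VFR I M) : joinVF I M (splitVF I M X) = X :=
  sub_add_cancel X _

theorem deriv_tCoord (X : VFR I M) (p : M × ℝ) :
    X.deriv (tCoord I M) p = vertical (X p) :=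
  mvfderiv_tCoord (X p)

theorem deriv_tCoord_joinVF (q : ProdMod I M) : (joinVF I M q).deriv (tCoord I M) = q.2 := by
  ext p
  rw [deriv_tCoord]
  change vertical (q.1.1 p) + q.2 p * 1 = q.2 p
  rw [q.1.2, zero_add, mul_one]

theorem splitVF_joinVF (q : ProdMod I M) : splitVF I M (joinVF I M q) = q := by
  refine Prod.ext (Subtype.ext ?_) (deriv_tCoord_joinVF q)
  change joinVF I M q - (joinVF I M q).deriv (tCoord I M) • ddt I M = q.1
  rw [deriv_tCoord_joinVF, joinVF_apply, add_sub_cancel_right]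

theorem splitVF_ddt : splitVF I M (ddt I M) = (0, 1) := by
  rw [← splitVF_joinVF (I := I) (M := M) (0, 1), joinVF_apply]
  simp

theorem splitVF_liftVF (X : VF I M) : splitVF I M (liftVF X) = (liftVF X, 0) := by
  rw [← splitVF_joinVF (I := I) (M := M) (liftVF X, 0), joinVF_apply]
  simp

theorem prodIdent_isDiffeo : (prodIdent I M).IsDiffeo :=
  GHom.isDiffeo_ofLinear (ψ := ContMDiffMap.id)
    (K := { toFun := joinVF I M
            map_add' := map_add _
            map_smul' := fun f q ↦ map_smul (joinVF I M) f q })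
    (fun _ ↦ rfl) (fun _ ↦ rfl) splitVF_joinVF joinVF_splitVF

theorem prodIdent_pullback_ι (X : VFR I M) :
    (prodIdent I M).pullback (ExteriorAlgebra.ι _ X) = ExteriorAlgebra.ι _ (splitVF I M X) :=
  GHom.ofLinear_pullback_ι _ _ X

theorem prodProj_pullback_ι (X : VF I M) :
    (prodProj I M).pullback (ExteriorAlgebra.ι _ X) = ExteriorAlgebra.ι _ (liftVF X, 0) :=
  GHom.ofLinear_pullback_ι _ _ X

theorem expT_mul_expT (r s : ℝ) : expT I M r * expT I M s = expT I M (r + s) := by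
  ext p
  change Real.exp (r * p.2) * Real.exp (s * p.2) = Real.exp ((r + s) * p.2)
  rw [← Real.exp_add, add_mul]

theorem expT_zero : expT I M 0 = 1 := by
  ext p
  change Real.exp (0 * p.2) = 1
  rw [zero_mul, Real.exp_zero]

theorem mvfderiv_expT (r : ℝ) (p : M × ℝ) : mvfderiv (I.prod 𝓘(ℝ, ℝ)) (expT I M r) p =
    (r * expT I M r p) • mvfderiv (I.prod 𝓘(ℝ, ℝ)) (tCoord I M) p := by
  have h : mvfderiv (I.prod 𝓘(ℝ, ℝ)) (expT I M r) p =
      (mvfderiv 𝓘(ℝ, ℝ) (fun t : ℝ ↦ Real.exp (r * t)) p.2).comp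
        (mfderiv (I.prod 𝓘(ℝ, ℝ)) 𝓘(ℝ, ℝ) (tCoord I M) p) :=
    mvfderiv_comp (g := fun t : ℝ ↦ Real.exp (r * t)) (f := tCoord I M) p (by
      have : DifferentiableAt ℝ (fun t : ℝ ↦ Real.exp (r * t)) p.2 := by fun_prop
      exact this.mdifferentiableAt) ((tCoord I M).contMDiff.mdifferentiable (by simp) _)
  have h1 : HasFDerivAt (fun t : ℝ ↦ Real.exp (r * t)) _ p.2 :=
    (((hasDerivAt_id p.2).const_mul r).exp).hasFDerivAt
  rw [h, mvfderiv, mfderiv_eq_fderiv, h1.fderiv]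
  ext v
  change mvfderiv (I.prod 𝓘(ℝ, ℝ)) (tCoord I M) p v * (Real.exp (r * p.2) * (r * 1)) =
    r * Real.exp (r * p.2) * mvfderiv (I.prod 𝓘(ℝ, ℝ)) (tCoord I M) p v
  ring

variable (I M) in
/-- The morphism of `T*[1]M × ℝ[1] × ℝ` which multiplies the fibre coordinates by `e^(rt)`. -/
noncomputable def scaling (r : ℝ) :
    GHom (I.prod 𝓘(ℝ, ℝ)) (M × ℝ) (ProdMod I M) (I.prod 𝓘(ℝ, ℝ)) (M × ℝ) (ProdMod I M) :=
  GHom.ofLinear ContMDiffMap.id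
    { toFun := fun q ↦ expT I M r • q
      map_add' := smul_add _
      map_smul' := fun f q ↦ smul_comm _ f q }

theorem scaling_isDiffeo (r : ℝ) : (scaling I M r).IsDiffeo :=
  GHom.isDiffeo_ofLinear (ψ := ContMDiffMap.id)
    (K := { toFun := fun q ↦ expT I M (-r) • q
            map_add' := smul_add _
            map_smul' := fun f q ↦ smul_comm _ f q })
    (fun _ ↦ rfl) (fun _ ↦ rfl)
    (fun q ↦ by
      change expT I M r • expT I M (-r) • q = q
      rw [smul_smul, expT_mul_expT, add_neg_cancel, expT_zero, one_smul])
    (fun q ↦ by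
      change expT I M (-r) • expT I M r • q = q
      rw [smul_smul, expT_mul_expT, neg_add_cancel, expT_zero, one_smul])

theorem scaling_pullback_algebraMap (r : ℝ) (f : SmR I M) :
    (scaling I M r).pullback (algebraMap _ _ f) = algebraMap _ _ f :=
  (scaling I M r).pullback_algebraMap f

theorem scaling_pullback_ι (r : ℝ) (q : ProdMod I M) :
    (scaling I M r).pullback (ExteriorAlgebra.ι _ q) =
      algebraMap _ _ (expT I M r) * ExteriorAlgebra.ι _ q := by
  rw [scaling, GHom.ofLinear_pullback_ι, ← Algebra.smul_def, ← map_smul]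
  rfl

theorem scaling_pullback (r : ℝ) (k : ℕ) (f : ProdFn I M) (hf : f ∈ ⋀[SmR I M]^k (ProdMod I M)) :
    (scaling I M r).pullback f = expT I M (k * r) • f := by
  induction k generalizing f with
  | zero =>
    rw [ExteriorAlgebra.exteriorPower, pow_zero, Submodule.mem_one] at hf
    obtain ⟨g, rfl⟩ := hf
    rw [scaling_pullback_algebraMap, Nat.cast_zero, zero_mul, expT_zero, one_smul]
  | succ n ih =>
    rw [ExteriorAlgebra.exteriorPower, pow_succ] at hf
    induction hf using Submodule.mul_induction_on' with
    | mem_mul_mem u hu v hv =>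
      obtain ⟨q, rfl⟩ := hv
      rw [map_mul, ih u hu, scaling_pullback_ι, ← Algebra.smul_def, smul_mul_smul_comm,
        expT_mul_expT, Nat.cast_succ, add_one_mul]
    | add u hu v hv hu' hv' => rw [map_add, hu', hv', smul_add]

theorem d_expForm : d (expForm I M) = expForm I M * dt I M := by
  refine Subtype.ext (funext fun p ↦ ?_)
  change (d (fn (algebraMap (SmR I M) _ (expT I M 1)))).1 p =
    fnGerm p (algebraMap (SmR I M) _ (expT I M 1)) *
      (d (fn (algebraMap (SmR I M) _ (tCoord I M)))).1 p
  rw [d_fn_apply, d_fn_apply]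
  have := sum_fnGerm_mul_dfnGerm (I := I.prod 𝓘(ℝ, ℝ)) (P := ProdMod I M) (x := p) (n := 2)
    ![-1, expT I M 1] ![expT I M 1, tCoord I M] (Filter.Eventually.of_forall fun y ↦ by
      rw [Fin.sum_univ_two]
      simp only [Matrix.cons_val_zero, Matrix.cons_val_one]
      rw [mvfderiv_expT, one_mul]
      change (-1 : ℝ) • _ + _ = _
      rw [neg_one_smul, neg_add_cancel])
  rw [Fin.sum_univ_two] at this
  simp only [Matrix.cons_val_zero, Matrix.cons_val_one, map_neg, map_one, neg_one_mul] at this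
  exact neg_add_eq_zero.1 this

theorem d_theta_mul_dt : d (fn (theta I M) * dt I M) = dt I M * dtheta I M :=
  d_fn_ι_mul_d_fn_algebraMap _ _

theorem smul_add_sum_smul {V : Type*} [AddCommGroup V] [Module ℝ V] {n : ℕ} (a : ℝ)
    (c : Fin n → ℝ) (X : Fin n → V) :
    a • ((0 : V), (1 : ℝ)) + ∑ i, c i • (X i, (0 : ℝ)) = (∑ i, c i • X i, a) := by
  refine Prod.ext ?_ ?_ <;> simp [Prod.fst_sum, Prod.snd_sum]

theorem isDualFrame_prod (p : M × ℝ) {n : ℕ} {f : Fin n → Sm I M} {X : Fin n → VF I M}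
    (h : IsDualFrame I p.1 f X) : IsDualFrame (I.prod 𝓘(ℝ, ℝ)) p
      (Fin.cons (tCoord I M) fun i ↦ (f i).comp ⟨Prod.fst, contMDiff_fst⟩)
      (Fin.cons (ddt I M) fun i ↦ (liftVF (X i) : VFR I M)) := by
  filter_upwards [continuous_fst.continuousAt.eventually h] with y hy v
  have h1 : ∀ i, mvfderiv (I.prod 𝓘(ℝ, ℝ)) ((f i).comp ⟨Prod.fst, contMDiff_fst⟩ : SmR I M) y v =
      mvfderiv I (f i) y.1 (Prod.fst (α := E) (β := ℝ) v) := by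
    intro i
    have h2 : mvfderiv (I.prod 𝓘(ℝ, ℝ)) ((f i).comp ⟨Prod.fst, contMDiff_fst⟩ : SmR I M) y =
        (mvfderiv I (f i) y.1).comp (mfderiv (I.prod 𝓘(ℝ, ℝ)) I Prod.fst y) :=
      mvfderiv_comp y ((f i).contMDiff.mdifferentiable (by simp) _) mdifferentiableAt_fst
    rw [h2, mfderiv_fst]
    rfl
  rw [Fin.sum_univ_succ]
  simp only [Fin.cons_zero, Fin.cons_succ, mvfderiv_tCoord, h1]
  exact (smul_add_sum_smul _ _ _).trans
    (Prod.ext (α := E) (β := ℝ) (hy (Prod.fst (α := E) (β := ℝ) v)) rfl)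

set_option maxHeartbeats 1000000 in
theorem scaling_pullForm_apply (r : ℝ) {s : ProdForm I M} {p : M × ℝ} {n : ℕ}
    {q : Fin n → ProdMod I M} {g : Fin n → SmR I M}
    (h : s.1 p = ∑ i, fnGerm p (ExteriorAlgebra.ι _ (q i)) * dfnGerm p (algebraMap _ _ (g i))) :
    ((scaling I M r).pullForm s).1 p = fnGerm p (algebraMap (SmR I M) _ (expT I M r)) * s.1 p := by
  refine ((scaling I M r).pullForm_apply_of_eq_sum (x := p) h).trans ?_
  rw [h, Finset.mul_sum]
  refine Finset.sum_congr rfl fun i _ ↦ ?_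
  rw [scaling_pullback_ι, scaling_pullback_algebraMap, map_mul, mul_assoc]

theorem scaling_pullForm_theta_mul_dt :
    (scaling I M 1).pullForm (fn (theta I M) * dt I M) =
      expForm I M * (fn (theta I M) * dt I M) := by
  have h1 : (scaling I M 1).pullForm (fn (theta I M)) = expForm I M * fn (theta I M) :=
    (GHom.pullForm_fn _ _).trans ((congrArg fn (scaling_pullback_ι 1 _)).trans (map_mul fn _ _))
  have h2 : (scaling I M 1).pullForm (dt I M) = dt I M :=
    (GHom.pullForm_d _ _).trans (congrArg d ((GHom.pullForm_fn _ _).trans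
      (congrArg fn (scaling_pullback_algebraMap 1 _))))
  exact (map_mul _ _ _).trans ((congrArg₂ (· * ·) h1 h2).trans (mul_assoc _ _ _))

section Symplectization

variable [FiniteDimensional ℝ E] [T2Space M]

theorem eq_scaling (r : ℝ)
    (ξ : GHom (I.prod 𝓘(ℝ, ℝ)) (M × ℝ) (ProdMod I M) (I.prod 𝓘(ℝ, ℝ)) (M × ℝ) (ProdMod I M))
    (h : ∀ (k : ℕ) (f : ProdFn I M), f ∈ ⋀[SmR I M]^k (ProdMod I M) →
      ξ.pullback f = expT I M (k * r) • f) : ξ = scaling I M r := by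
  refine GHom.ext_of_pullback fun a ↦ ?_
  induction a using DirectSum.Decomposition.inductionOn (fun k ↦ ⋀[SmR I M]^k (ProdMod I M)) with
  | zero => rw [map_zero, map_zero]
  | homogeneous a => rw [h _ _ a.2, scaling_pullback _ _ _ a.2]
  | add a b ha hb => rw [map_add, map_add, ha, hb]

theorem d_prodLiouville : d (prodLiouville I M) = prodOmega I M :=
  ((prodProj I M).pullForm_d _).symm

theorem symplectizationForm_eq : symplectizationForm I M =
    expForm I M * (dt I M * (dtheta I M + prodLiouville I M) + prodOmega I M) :=
  d_fn_mul_add d_expForm d_prodLiouville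

theorem prodLiouville_apply {p : M × ℝ} {n : ℕ} {f : Fin n → Sm I M} {X : Fin n → VF I M}
    (h : IsDualFrame I p.1 f X) : (prodLiouville I M).1 p =
      ∑ i, fnGerm p (ExteriorAlgebra.ι _ (liftVF (X i), (0 : SmR I M))) *
        dfnGerm p (algebraMap (SmR I M) _ ((f i).comp ⟨Prod.fst, contMDiff_fst⟩)) := by
  refine ((prodProj I M).pullForm_liouville_apply (x := p) h).trans ?_
  simp only [prodProj_pullback_ι]
  rfl

set_option maxHeartbeats 1000000 in
/-- The Liouville form of `T*[1](M × ℝ)` is `λ + θ dt`. -/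
theorem prodIdent_pullForm_liouville :
    (prodIdent I M).pullForm (liouville (I.prod 𝓘(ℝ, ℝ)) (M × ℝ)) =
      prodLiouville I M + fn (theta I M) * dt I M := by
  refine Subtype.ext (funext fun p ↦ ?_)
  obtain ⟨n, f, X, h⟩ := exists_isDualFrame I p.1
  refine ((prodIdent I M).pullForm_liouville_apply (x := p) (isDualFrame_prod p h)).trans ?_
  refine Eq.trans ?_ (congrArg₂ (· + ·) (prodLiouville_apply h).symm
    (congrArg (fnGerm p (theta I M) * ·) (d_fn_apply _ p).symm))
  rw [Fin.sum_univ_succ, add_comm]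
  simp only [Fin.cons_zero, Fin.cons_succ, prodIdent_pullback_ι]
  rw [splitVF_ddt]
  simp only [splitVF_liftVF]
  rfl

theorem scaling_pullForm_prodLiouville :
    (scaling I M 1).pullForm (prodLiouville I M) = expForm I M * prodLiouville I M := by
  refine Subtype.ext (funext fun p ↦ ?_)
  obtain ⟨n, f, X, h⟩ := exists_isDualFrame I p.1
  exact scaling_pullForm_apply 1 (prodLiouville_apply h)

theorem prodCanonicalForm_eq :
    prodCanonicalForm I M = prodOmega I M + dt I M * dtheta I M :=
  ((prodIdent I M).pullForm_d _).trans <| (congrArg d prodIdent_pullForm_liouville).trans <|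
    (map_add d _ _).trans (congrArg₂ (· + ·) d_prodLiouville d_theta_mul_dt)

theorem scaling_pullForm_prodCanonicalForm :
    (scaling I M 1).pullForm (prodCanonicalForm I M) = symplectizationForm I M := by
  have h1 : (scaling I M 1).pullForm (prodLiouville I M + fn (theta I M) * dt I M) =
      expForm I M * (prodLiouville I M + fn (theta I M) * dt I M) :=
    (map_add _ _ _).trans ((congrArg₂ (· + ·) scaling_pullForm_prodLiouville
      scaling_pullForm_theta_mul_dt).trans (mul_add _ _ _).symm)
  have h2 : prodCanonicalForm I M = d (prodLiouville I M + fn (theta I M) * dt I M) :=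
    ((prodIdent I M).pullForm_d _).trans (congrArg d prodIdent_pullForm_liouville)
  exact (congrArg _ h2).trans (((scaling I M 1).pullForm_d _).trans ((congrArg d h1).trans
    ((d_fn_mul_add_fn_mul_d d_expForm d_prodLiouville).trans symplectizationForm_eq.symm)))

end Symplectization

end Product

end DegOne

theorem mainTheorem8 {E : Type*} [NormedAddCommGroup E] [NormedSpace ℝ E] [FiniteDimensional ℝ E]
    {H : Type*} [TopologicalSpace H] (I : ModelWithCorners ℝ E H) [I.Boundaryless]
    (M : Type*) [TopologicalSpace M] [ChartedSpace H M] [IsManifold I ∞ M]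
    [T2Space M] [SigmaCompactSpace M] :
    (prodIdent I M).IsDiffeo ∧
    prodCanonicalForm I M = prodOmega I M + dt I M * dtheta I M ∧
    symplectizationForm I M =
      expForm I M * (dt I M * (dtheta I M + prodLiouville I M) + prodOmega I M) ∧
    ∃ ξ : GHom (I.prod 𝓘(ℝ, ℝ)) (M × ℝ) (ProdMod I M) (I.prod 𝓘(ℝ, ℝ)) (M × ℝ) (ProdMod I M),
      ξ.IsDiffeo ∧
      (∀ (k : ℕ) (f : ProdFn I M), f ∈ ⋀[SmR I M]^k (ProdMod I M) →
        ξ.pullback f = expT I M k • f) ∧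
      (∀ ξ' : GHom (I.prod 𝓘(ℝ, ℝ)) (M × ℝ) (ProdMod I M)
          (I.prod 𝓘(ℝ, ℝ)) (M × ℝ) (ProdMod I M),
        (∀ (k : ℕ) (f : ProdFn I M), f ∈ ⋀[SmR I M]^k (ProdMod I M) →
          ξ'.pullback f = expT I M k • f) → ξ' = ξ) ∧
      ξ.pullForm (prodCanonicalForm I M) = symplectizationForm I M := by
  refine ⟨prodIdent_isDiffeo, prodCanonicalForm_eq, symplectizationForm_eq, scaling I M 1,
    scaling_isDiffeo 1, fun k f hf ↦ ?_, fun ξ hξ ↦ eq_scaling 1 ξ fun k f hf ↦ ?_,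
    scaling_pullForm_prodCanonicalForm⟩
  · rw [scaling_pullback 1 k f hf, mul_one]
  · rw [hξ k f hf, mul_one]
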